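/- **Setting.** Let $\Sigma = CS\cup FS$ be a signature of constructor symbols and function symbols with arities, and $\mathcal V$ a denumerable set of variables. Let-expressions are $e ::= X \mid h(e_1,\dots,e_n) \mid let\ X=e_1\ in\ e_2$ ($X\in\mathcal V$, $h\in\Sigma$ of arity $n$; the let is not recursive). They are considered up to renaming of let-bound variables ($\equiv$), and substitutions are applied without capture. $FV(e)$ is the set of free variables of $e$. A c-term is built from variables and constructors only. A substitution has finite domain $dom(\theta)=\{X\mid X\theta\neq X\}$, and $vRan(\theta)=\bigcup_{X\in dom(\theta)}FV(X\theta)$. $CSubst$ is the set of substitutions with c-terms as values, $\epsilon$ is the identity, $\sigma\theta$ is "first $\sigma$, then $\theta$", and $\sigma=\theta\,[W]$ means $X\sigma\equiv X\theta$ for all $X\in W$. For a one-hole context $\mathcal C$ (with lets), $BV(\mathcal C)$ is the set of the let-bound variables of $\mathcal C$ that are visible at its hole; these are taken distinct from all free variables and from the variables of program rules. A program $\mathcal P$ is any set of rules $f(p_1,\dots,p_n)\to r$ with $f\in FS$, $(p_1,\dots,p_n)$ a linear tuple of c-terms and $r$ a let-expression, possibly with extra variables. **Let-rewriting** $\to^l$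 (one step, in any context $\mathcal C$, possibly $[\ ]$): (Fapp) $\mathcal C[f(\overline p)\theta]\to^l\mathcal C[r\theta]$ for $(f(\overline p)\to r)\in\mathcal P$ and a c-substitution $\theta$ with $vRan(\theta|_{\setminus var(\overline p)})\cap BV(\mathcal C)=\emptyset$; (LetIn) $\mathcal C[h(\dots,e,\dots)]\to^l\mathcal C[let\ X=e\ in\ h(\dots,X,\dots)]$ if $e$ is a let or has a function symbol at its root, $X$ fresh; (Bind) $\mathcal C[let\ X=t\ in\ e]\to^l\mathcal C[e[X/t]]$ if $t$ is a c-term; (Elim) $\mathcal C[let\ X=e_1\ in\ e_2]\to^l\mathcal C[e_2]$ if $X\notin FV(e_2)$; (Flat) $\mathcal C[let\ X=(let\ Y=e_1\ in\ e_2)\ in\ e_3]\to^l\mathcal C[let\ Y=e_1\ in\ let\ X=e_2\ in\ e_3]$ if $Y\notin FV(e_3)$. **Let-narrowing** $e\leadsto_\sigma e'$ (one step): either $\sigma=\epsilon$ and $e\to^l e'$ by (LetIn), (Bind), (Elim) or (Flat); or (Narr) $\mathcal C[f(\overline t)]\leadsto_{\sigma}\mathcal C\sigma[r\theta]$ with $\sigma=\theta|_{\setminus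 var(\overline p)}$, where $f(\overline p)\to r$ is a variant of a rule of $\mathcal P$ whose variables do not occur in $\mathcal C[f(\overline t)]$, and $\theta$ is a c-substitution with $f(\overline t)\theta\equiv f(\overline p)\theta$, $dom(\theta)\cap BV(\mathcal C)=\emptyset$ and $vRan(\theta|_{\setminus var(\overline p)})\cap BV(\mathcal C)=\emptyset$. A derivation $e\leadsto^*_\sigma e'$ is a finite (possibly empty) sequence of steps, $\sigma$ being the composition of the substitutions of its steps. A standard mgu is an idempotent most general unifier whose domain and range only use variables of the unified expressions; the variables in $BV(\mathcal C)$ are not substituted and count as constants in this unification. **Theorem (adequacy of let-narrowing with respect to let-rewriting).** Let $\mathcal P$ be a program, $e,e_1$ let-expressions and $\theta\in CSubst$. Then $$e\theta\,(\to^{l})^*\,e_1\iff\text{there are a derivation } e\leadsto^*_\sigma e_2 \text{ and } \theta'\in CSubst \text{ such that } \sigma\theta'=\theta\,[FV(e)] \text{ and } e_2\theta'\equiv e_1.$$ Moreover, if $e\theta\,(\to^{l})^*\,e_1$, then the derivation $e\leadsto^*_\sigma e_2$ and $\theta'$ on the right-hand side can be chosen such that every (Narr) step of the derivation uses as its unifier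 a standard mgu of $f(\overline t)$ and $f(\overline p)$. -/

import Mathlib

namespace LetNarrowing

universe u v w

/-- A first order signature `Σ = CS ∪ FS`: constructor symbols, (defined) function symbols,
and an arity for each of them. -/
structure Signature where
  Con : Type u
  Fn : Type v
  arity : Con ⊕ Fn → ℕ

variable {S : Signature.{u, v}} {V : Type w}

/-- Let-expressions over the variables `V`, up to renaming of let-bound variables: a free variable
is a name `X : V`, a bound variable is a de Bruijn index. `LExp S V k` contains the expressions
found in the scope of `k` surrounding lets, so that they may mention the variables
`bound 0` (innermost let), …, `bound (k - 1)` bound by the surroundings.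
The let-expressions proper are those of `LExp S V 0`, and `=` on them is equality modulo the
renaming of bound variables. -/
inductive LExp (S : Signature.{u, v}) (V : Type w) : ℕ → Type (max u v w)
  | free {k : ℕ} (X : V) : LExp S V k
  | bound {k : ℕ} (i : Fin k) : LExp S V k
  | app {k : ℕ} (h : S.Con ⊕ S.Fn) (args : Fin (S.arity h) → LExp S V k) : LExp S V k
  /-- `letE e₁ e₂` is `let X = e₁ in e₂` (not recursive), `X` being `bound 0` in `e₂`. -/
  | letE {k : ℕ} (e₁ : LExp S V k) (e₂ : LExp S V (k + 1)) : LExp S V k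

namespace LExp

/-- The set `FV(e)` of free (named) variables. -/
def FV : {k : ℕ} → LExp S V k → Set V
  | _, free X => {X}
  | _, bound _ => ∅
  | _, app _ args => ⋃ i, FV (args i)
  | _, letE e₁ e₂ => FV e₁ ∪ FV e₂

open Classical in
/-- The number of occurrences of the named variable `X`. -/
noncomputable def occ (X : V) : {k : ℕ} → LExp S V k → ℕ
  | _, free Y => if Y = X then 1 else 0
  | _, bound _ => 0
  | _, app _ args => ∑ i, occ X (args i)
  | _, letE e₁ e₂ => occ X e₁ + occ X e₂

/-- c-terms: no function symbols and no lets. They may contain variables bound by the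
surroundings. -/
inductive IsCTerm {k : ℕ} : LExp S V k → Prop
  | free (X : V) : IsCTerm (free X)
  | bound (i : Fin k) : IsCTerm (bound i)
  | con (c : S.Con) (args : Fin (S.arity (Sum.inl c)) → LExp S V k)
      (h : ∀ i, IsCTerm (args i)) : IsCTerm (app (Sum.inl c) args)

/-- Renaming of the variables bound by the surroundings. -/
def rename : {k m : ℕ} → (Fin k → Fin m) → LExp S V k → LExp S V m
  | _, _, _, free X => free X
  | _, _, r, bound i => bound (r i)
  | _, _, r, app h args => app h (fun i => rename r (args i))
  | _, _, r, letE e₁ e₂ =>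
      letE (rename r e₁) (rename (Fin.cases 0 (fun i => (r i).succ)) e₂)

/-- The same expression, placed below one more let whose variable it does not mention. -/
def weaken {k : ℕ} (e : LExp S V k) : LExp S V (k + 1) := e.rename Fin.succ

/-- The same expression, placed below `k` lets whose variables it does not mention. -/
def embed {k : ℕ} (e : LExp S V 0) : LExp S V k := e.rename Fin.elim0

/-- Simultaneous capture-avoiding replacement of the free variables by `φ` and of
the variables bound by the surroundings by `β`. -/
def replace : {k m : ℕ} → (V → LExp S V m) → (Fin k → LExp S V m) → LExp S V k → LExp S V m
  | _, _, φ, _, free X => φ X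
  | _, _, _, β, bound i => β i
  | _, _, φ, β, app h args => app h (fun i => replace φ β (args i))
  | _, _, φ, β, letE e₁ e₂ =>
      letE (replace φ β e₁)
        (replace (fun X => (φ X).weaken) (Fin.cases (bound 0) (fun i => (β i).weaken)) e₂)

/-- `e θ`: capture-avoiding application of a substitution. Let-bound variables are never
in the domain of a substitution. -/
def subst {k : ℕ} (e : LExp S V k) (θ : V → LExp S V k) : LExp S V k :=
  e.replace θ bound

/-- `e[X/t]`, for the variable `X = bound 0` of the innermost let around `e`. -/
def instantiate {k : ℕ} (e : LExp S V (k + 1)) (t : LExp S V k) : LExp S V k :=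
  e.replace free (Fin.cases t bound)

/-- `e ≡ f(e₁, …, eₙ)` with `f ∈ FS`, or `e` is a let. -/
def IsCallOrLet {k : ℕ} (e : LExp S V k) : Prop :=
  (∃ f args, e = app (Sum.inr f) args) ∨ ∃ e₁ e₂, e = letE e₁ e₂

/-- `e` mentions no variable bound by the surroundings. -/
def NoBound {k : ℕ} (e : LExp S V k) : Prop := ∃ e₀ : LExp S V 0, e = e₀.embed

end LExp

open LExp

/-- Substitutions: the domain `{X | Xθ ≠ X}` is finite. For `k > 0` these are
substitutions whose values may mention the variables bound by `k` surrounding lets. -/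
def IsSubst {k : ℕ} (θ : V → LExp S V k) : Prop := {X | θ X ≠ free X}.Finite

/-- c-substitutions. The set `CSubst` is the case `k = 0`. -/
def IsCSubst {k : ℕ} (θ : V → LExp S V k) : Prop := IsSubst θ ∧ ∀ X, (θ X).IsCTerm

/-- One-hole contexts: `Ctx S V m k` are the contexts in the scope of `m` surrounding lets whose
hole is in the scope of `k` lets (the context itself binds `k - m` variables at its hole). -/
inductive Ctx (S : Signature.{u, v}) (V : Type w) : ℕ → ℕ → Type (max u v w)
  | hole {m : ℕ} : Ctx S V m m
  /-- `h(…, C, …)` with `C` at position `i` (the entry `args i` is overwritten). -/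
  | app {m k : ℕ} (h : S.Con ⊕ S.Fn) (args : Fin (S.arity h) → LExp S V m)
      (i : Fin (S.arity h)) (C : Ctx S V m k) : Ctx S V m k
  /-- `let X = C in e` -/
  | letDef {m k : ℕ} (C : Ctx S V m k) (e : LExp S V (m + 1)) : Ctx S V m k
  /-- `let X = e in C` -/
  | letBody {m k : ℕ} (e : LExp S V m) (C : Ctx S V (m + 1) k) : Ctx S V m k

namespace Ctx

/-- `C[e]` -/
def plug : {m k : ℕ} → Ctx S V m k → LExp S V k → LExp S V m
  | _, _, hole, e => e
  | _, _, app h args i C, e => LExp.app h (Function.update args i (plug C e))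
  | _, _, letDef C e', e => LExp.letE (plug C e) e'
  | _, _, letBody e' C, e => LExp.letE e' (plug C e)

/-- `Cθ` -/
def subst : {m k : ℕ} → Ctx S V m k → (V → LExp S V m) → Ctx S V m k
  | _, _, hole, _ => hole
  | _, _, app h args i C, θ => app h (fun j => (args j).subst θ) i (subst C θ)
  | _, _, letDef C e, θ => letDef (subst C θ) (e.subst (fun X => (θ X).weaken))
  | _, _, letBody e C, θ => letBody (e.subst θ) (subst C (fun X => (θ X).weaken))

end Ctx

/-- Program rules `f(p₁, …, pₙ) → r`: a linear tuple of c-terms on the left, a let-expression,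
possibly with extra variables, on the right. -/
structure Rule (S : Signature.{u, v}) (V : Type w) where
  f : S.Fn
  pats : Fin (S.arity (Sum.inr f)) → LExp S V 0
  rhs : LExp S V 0
  pats_cterm : ∀ i, (pats i).IsCTerm
  linear : ∀ X, ∑ i, (pats i).occ X ≤ 1

namespace Rule

/-- The patterns of the variant of a rule that is obtained by the renaming `ρ`. -/
def variantPats (R : Rule S V) (ρ : Equiv.Perm V) :
    Fin (S.arity (Sum.inr R.f)) → LExp S V 0 :=
  fun i => (R.pats i).subst (fun X => free (ρ X))

/-- The right-hand side of the variant of a rule that is obtained by the renaming `ρ`. -/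
def variantRhs (R : Rule S V) (ρ : Equiv.Perm V) : LExp S V 0 :=
  R.rhs.subst (fun X => free (ρ X))

end Rule

/-- The variables of a tuple of expressions. -/
def tupleVars {n k : ℕ} (es : Fin n → LExp S V k) : Set V := ⋃ i, (es i).FV

/-- The rules (LetIn), (Bind), (Elim) and (Flat), applied at the root of an expression in the
scope of `k` lets. -/
inductive LetRule {k : ℕ} : LExp S V k → LExp S V k → Prop
  /-- `h(…, e, …) → let X = e in h(…, X, …)`, `X` fresh -/
  | letIn (h : S.Con ⊕ S.Fn) (args : Fin (S.arity h) → LExp S V k) (i : Fin (S.arity h))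
      (hi : (args i).IsCallOrLet) :
      LetRule (app h args)
        (letE (args i) (app h (Function.update (fun j => (args j).weaken) i (bound 0))))
  /-- `let X = t in e → e[X/t]`, `t` a c-term -/
  | bind (t : LExp S V k) (e : LExp S V (k + 1)) (ht : t.IsCTerm) :
      LetRule (letE t e) (e.instantiate t)
  /-- `let X = e₁ in e₂ → e₂`, `X` not in `e₂` -/
  | elim (e₁ e₂ : LExp S V k) : LetRule (letE e₁ e₂.weaken) e₂
  /-- `let X = (let Y = e₁ in e₂) in e₃ → let Y = e₁ in let X = e₂ in e₃`, `Y` not in `e₃` -/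
  | flat (e₁ : LExp S V k) (e₂ e₃ : LExp S V (k + 1)) :
      LetRule (letE (letE e₁ e₂) e₃)
        (letE e₁ (letE e₂ (e₃.rename (Fin.cases 0 (fun i => i.succ.succ)))))

/-- One step of let-rewriting with the program `P`. The context rule is built in; the empty
context `C` gives the rules at the root. -/
inductive LetRw (P : Set (Rule S V)) : LExp S V 0 → LExp S V 0 → Prop
  | letRule {k : ℕ} (C : Ctx S V 0 k) {e e' : LExp S V k} (h : LetRule e e') :
      LetRw P (C.plug e) (C.plug e')
  /-- (Fapp): `C[f(p₁, …, pₙ)θ] → C[rθ]` for a c-substitution `θ`. Outside the variables of the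
  patterns, `θ` does not introduce variables bound by `C`. -/
  | fapp {k : ℕ} (C : Ctx S V 0 k) (R : Rule S V) (hR : R ∈ P)
      (θ : V → LExp S V k) (hθ : IsCSubst θ)
      (hExtra : ∀ X, X ∉ tupleVars R.pats → (θ X).NoBound) :
      LetRw P (C.plug (app (Sum.inr R.f) (fun i => (R.pats i).embed.subst θ)))
        (C.plug (R.rhs.embed.subst θ))

/-- `θ` unifies the tuples `t` and `p`. -/
def IsUnifier {n k : ℕ} (t p : Fin n → LExp S V k) (θ : V → LExp S V k) : Prop :=
  ∀ i, (t i).subst θ = (p i).subst θ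

/-- `θ` is a standard mgu of the tuples `t` and `p`: an idempotent most general unifier whose
domain and range use only variables of `t` and `p`. -/
def IsStandardMGU {n k : ℕ} (t p : Fin n → LExp S V k) (θ : V → LExp S V k) : Prop :=
  IsUnifier t p θ ∧
  (∀ τ : V → LExp S V k, IsSubst τ → IsUnifier t p τ →
    ∃ ρ : V → LExp S V k, IsSubst ρ ∧ ∀ X, τ X = (θ X).subst ρ) ∧
  (∀ X, (θ X).subst θ = θ X) ∧
  (∀ X, θ X ≠ free X → X ∈ tupleVars t ∪ tupleVars p ∧ (θ X).FV ⊆ tupleVars t ∪ tupleVars p)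

/-- One step `e ⇝_σ e'` of let-narrowing with the program `P`. The context rule is built in; the
empty context `C` gives the rules at the root. If `onlyMGU` holds, (Narr) steps have to
use a standard mgu. -/
inductive LetNarr (P : Set (Rule S V)) (onlyMGU : Prop) :
    LExp S V 0 → (V → LExp S V 0) → LExp S V 0 → Prop
  | letRule {k : ℕ} (C : Ctx S V 0 k) {e e' : LExp S V k} (h : LetRule e e') :
      LetNarr P onlyMGU (C.plug e) free (C.plug e')
  /-- (Narr): `C[f(t)] ⇝ Cθ[rθ]` for a fresh variant `f(p) → r` of a rule of `P` and a
  c-substitution `θ` with `f(t)θ ≡ f(p)θ`. Substitutions never act on variables bound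
  by `C`, and `hσ` says that outside the variables of `p` the substitution `θ` does not introduce
  such variables. The step is decorated by `σ`, the restriction of `θ` to the variables
  outside `p`; the variables of `p` are fresh, and only their values can mention variables bound
  by `C`. -/
  | narr {k : ℕ} (C : Ctx S V 0 k) (R : Rule S V) (hR : R ∈ P) (ρ : Equiv.Perm V)
      (t : Fin (S.arity (Sum.inr R.f)) → LExp S V k)
      (hfresh : Disjoint (tupleVars (R.variantPats ρ) ∪ (R.variantRhs ρ).FV)
        (C.plug (app (Sum.inr R.f) t)).FV)
      (θ : V → LExp S V k) (hθ : IsCSubst θ)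
      (hunif : IsUnifier t (fun i => (R.variantPats ρ i).embed) θ)
      (hmgu : onlyMGU → IsStandardMGU t (fun i => (R.variantPats ρ i).embed) θ)
      (σ : V → LExp S V 0)
      (hσ : ∀ X, X ∉ tupleVars (R.variantPats ρ) → θ X = (σ X).embed)
      (hσp : ∀ X, X ∈ tupleVars (R.variantPats ρ) → σ X = free X) :
      LetNarr P onlyMGU (C.plug (app (Sum.inr R.f) t)) σ
        ((C.subst σ).plug ((R.variantRhs ρ).embed.subst θ))

/-- Let-narrowing derivations `e ⇝*_σ e'`, where `σ = θ₁ … θₙ` is the composition of the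
substitutions of the steps (from left to right). -/
inductive LetNarrStar (P : Set (Rule S V)) (onlyMGU : Prop) :
    LExp S V 0 → (V → LExp S V 0) → LExp S V 0 → Prop
  | refl (e : LExp S V 0) : LetNarrStar P onlyMGU e free e
  | head {e e' e'' : LExp S V 0} {θ σ : V → LExp S V 0}
      (h : LetNarr P onlyMGU e θ e') (hs : LetNarrStar P onlyMGU e' σ e'') :
      LetNarrStar P onlyMGU e (fun X => (θ X).subst σ) e''

end LetNarrowing

/-! Soundness. A narrowing step `e ⇝_σ e'` gives a rewriting step from `eσ` to `e'`
(`LetNarr.sound`). Let-rewriting is closed under c-substitutions (`LetRw.subst`), so these steps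
compose along a derivation, and `eθ ≡ eσθ' →* e₂θ' ≡ e₁`.

Completeness. Rewriting is lifted step by step (`LetRw.lift`). A redex is never a c-term, so in `eθ`
it cannot lie inside a value of `θ`: it is an instance of a subexpression of `e`
(`Ctx.exists_plug_of_subst_eq_plug`). C-substitutions reflect the side conditions of the four let
rules (`LetRule.of_subst`), so these rules already apply to `e`, with `σ = ε`. For (Fapp), the rule
is renamed apart; then `θ` and the matching substitution combine into a unifier `μ`, and there is a
standard mgu `δ` with `δμ = μ`. Outside the pattern variables `σ` is `δ`, and `θ'` is `μ` on the
range of `δ`. The delicate point, settled in `LetNarr.lift_fapp`, is that neither mentions let-bound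
variables visible at the hole. Only standard mgus are used, which gives the final claim. -/

namespace LetNarrowing

universe u v w

variable {S : Signature.{u, v}} {V : Type w}

/-! ### Substitution calculus for let-expressions with de Bruijn indices -/

namespace LExp

variable {k m n : ℕ}

theorem lift_comp (s : Fin m → Fin n) (r : Fin k → Fin m) :
    (fun i => (Fin.cases 0 (fun i => (s i).succ) : Fin (m + 1) → Fin (n + 1))
      ((Fin.cases 0 (fun i => (r i).succ) : Fin (k + 1) → Fin (m + 1)) i)) =
      Fin.cases 0 (fun i => (s (r i)).succ) := by
  funext i; cases i using Fin.cases <;> rfl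

theorem rename_rename (e : LExp S V k) (r : Fin k → Fin m) (s : Fin m → Fin n) :
    (e.rename r).rename s = e.rename (fun i => s (r i)) := by
  induction e generalizing m n with
  | free X => rfl
  | bound i => rfl
  | app h args ih => simp only [rename, ih]
  | letE e₁ e₂ ih₁ ih₂ => simp only [rename, ih₁, ih₂, lift_comp]

theorem replace_rename (e : LExp S V k) (r : Fin k → Fin m) (φ : V → LExp S V n)
    (β : Fin m → LExp S V n) :
    (e.rename r).replace φ β = e.replace φ (fun i => β (r i)) := by
  induction e generalizing m n with
  | free X => rfl
  | bound i => rfl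
  | app h args ih => simp only [rename, replace, ih]
  | letE e₁ e₂ ih₁ ih₂ =>
    simp only [rename, replace, ih₁, ih₂]
    congr 2
    funext i; cases i using Fin.cases <;> rfl

theorem weaken_rename (e : LExp S V k) (s : Fin k → Fin m) :
    e.weaken.rename (Fin.cases 0 (fun i => (s i).succ)) = (e.rename s).weaken := by
  simp only [weaken, rename_rename]; rfl

theorem rename_replace (e : LExp S V k) (φ : V → LExp S V m) (β : Fin k → LExp S V m)
    (s : Fin m → Fin n) :
    (e.replace φ β).rename s = e.replace (fun X => (φ X).rename s) (fun i => (β i).rename s) := by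
  induction e generalizing m n with
  | free X => rfl
  | bound i => rfl
  | app h args ih => simp only [rename, replace, ih]
  | letE e₁ e₂ ih₁ ih₂ =>
    simp only [rename, replace, ih₁, ih₂, weaken_rename]
    congr 2
    funext i; cases i using Fin.cases
    · rfl
    · exact weaken_rename _ _

theorem weaken_replace (e : LExp S V k) (φ : V → LExp S V m) (β : Fin k → LExp S V m) :
    e.weaken.replace (fun X => (φ X).weaken) (Fin.cases (bound 0) (fun i => (β i).weaken)) =
      (e.replace φ β).weaken := by
  simp only [weaken, replace_rename, rename_replace]; rfl

/-- `subst` and `instantiate` are both instances of `replace`, so their composition and commutation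
laws come from this one. Below a let both maps are lifted, and `weaken_replace` makes lifting
commute with replacing. -/
theorem replace_replace (e : LExp S V k) (φ : V → LExp S V m) (β : Fin k → LExp S V m)
    (φ' : V → LExp S V n) (β' : Fin m → LExp S V n) :
    (e.replace φ β).replace φ' β' =
      e.replace (fun X => (φ X).replace φ' β') (fun i => (β i).replace φ' β') := by
  induction e generalizing m n with
  | free X => rfl
  | bound i => rfl
  | app h args ih => simp only [replace, ih]
  | letE e₁ e₂ ih₁ ih₂ =>
    simp only [replace, ih₁, ih₂, weaken_replace]
    congr 2
    funext i; cases i using Fin.cases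
    · rfl
    · exact weaken_replace _ _ _

theorem replace_congr (e : LExp S V k) {φ φ' : V → LExp S V m} (β : Fin k → LExp S V m)
    (h : ∀ X ∈ e.FV, φ X = φ' X) : e.replace φ β = e.replace φ' β := by
  induction e generalizing m with
  | free X => exact h X rfl
  | bound i => rfl
  | app g args ih =>
    simp only [replace]
    congr 1
    funext i
    exact ih i β fun X hX => h X (Set.mem_iUnion.2 ⟨i, hX⟩)
  | letE e₁ e₂ ih₁ ih₂ =>
    simp only [replace]
    rw [ih₁ β fun X hX => h X (Or.inl hX), ih₂ _ fun X hX => by rw [h X (Or.inr hX)]]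

theorem lift_bound :
    (Fin.cases (bound 0) (fun i => (bound i).weaken) : Fin (k + 1) → LExp S V (k + 1)) =
      bound := by
  funext i; cases i using Fin.cases <;> rfl

theorem rename_eq_replace (e : LExp S V k) (r : Fin k → Fin m) :
    e.rename r = e.replace free (fun i => bound (r i)) := by
  induction e generalizing m with
  | free X => rfl
  | bound i => rfl
  | app h args ih => simp only [rename, replace, ih]
  | letE e₁ e₂ ih₁ ih₂ =>
    simp only [rename, replace, ih₁, ih₂]
    congr 2
    funext i; cases i using Fin.cases <;> rfl

theorem rename_id (e : LExp S V k) : e.rename (fun i => i) = e := by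
  induction e with
  | free X => rfl
  | bound i => rfl
  | app h args ih => simp only [rename, ih]
  | letE e₁ e₂ ih₁ ih₂ =>
    simp only [rename, ih₁]
    congr 1
    convert ih₂ using 2
    funext i; cases i using Fin.cases <;> rfl

@[simp] theorem subst_free (e : LExp S V k) : e.subst free = e := by
  have h := rename_eq_replace e fun i => i
  rw [rename_id] at h
  exact h.symm

@[simp] theorem free_subst (X : V) (θ : V → LExp S V k) : (free X).subst θ = θ X := rfl

@[simp] theorem bound_subst (i : Fin k) (θ : V → LExp S V k) : (bound i).subst θ = bound i := rfl

@[simp] theorem app_subst (h : S.Con ⊕ S.Fn) (args : Fin (S.arity h) → LExp S V k)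
    (θ : V → LExp S V k) : (app h args).subst θ = app h (fun i => (args i).subst θ) := rfl

@[simp] theorem letE_subst (e₁ : LExp S V k) (e₂ : LExp S V (k + 1)) (θ : V → LExp S V k) :
    (letE e₁ e₂).subst θ = letE (e₁.subst θ) (e₂.subst fun X => (θ X).weaken) := by
  simp only [subst, replace, lift_bound]

theorem subst_subst (e : LExp S V k) (θ τ : V → LExp S V k) :
    (e.subst θ).subst τ = e.subst fun X => (θ X).subst τ :=
  replace_replace ..

theorem subst_congr {e : LExp S V k} {θ τ : V → LExp S V k} (h : ∀ X ∈ e.FV, θ X = τ X) :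
    e.subst θ = e.subst τ :=
  replace_congr e _ h

theorem rename_subst (e : LExp S V k) (r : Fin k → Fin m) (θ : V → LExp S V k) :
    (e.rename r).subst (fun X => (θ X).rename r) = (e.subst θ).rename r := by
  simp only [subst, replace_rename, rename_replace]; rfl

theorem weaken_subst (e : LExp S V k) (θ : V → LExp S V k) :
    e.weaken.subst (fun X => (θ X).weaken) = (e.subst θ).weaken :=
  rename_subst ..

theorem embed_subst (e : LExp S V 0) (θ : V → LExp S V 0) :
    (e.embed : LExp S V k).subst (fun X => (θ X).embed) = (e.subst θ).embed :=
  rename_subst ..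

theorem rename_eq_embed (e : LExp S V 0) (r : Fin 0 → Fin k) : e.rename r = e.embed := by
  rw [embed, Subsingleton.elim r Fin.elim0]

theorem instantiate_subst (e : LExp S V (k + 1)) (t : LExp S V k) (θ : V → LExp S V k) :
    (e.subst fun X => (θ X).weaken).instantiate (t.subst θ) = (e.instantiate t).subst θ := by
  simp only [subst, instantiate, replace_replace]
  congr 1
  · funext X
    simp only [weaken, replace_rename]
    exact subst_free _
  · funext i; cases i using Fin.cases <;> rfl

theorem rename_injective {r : Fin k → Fin m} (hr : Function.Injective r) :
    Function.Injective (rename r : LExp S V k → LExp S V m) := by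
  intro e
  induction e generalizing m with
  | free X => intro e' h; cases e' <;> simp_all [rename]
  | bound i =>
    intro e' h
    cases e' <;> simp_all [rename]
    exact hr h
  | app g args ih =>
    intro e' h
    cases e' with
    | app g' args' =>
      simp only [rename, app.injEq] at h
      obtain ⟨rfl, h⟩ := h
      congr 1
      funext i
      exact ih i hr (congrFun (eq_of_heq h) i)
    | _ => simp [rename] at h
  | letE e₁ e₂ ih₁ ih₂ =>
    intro e' h
    cases e' with
    | letE e₁' e₂' =>
      simp only [rename, letE.injEq] at h
      rw [ih₁ hr h.1, ih₂ _ h.2]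
      intro i j hij
      cases i using Fin.cases <;> cases j using Fin.cases <;>
        simp only [Fin.cases_zero, Fin.cases_succ, Fin.succ_inj, hr.eq_iff] at hij ⊢
      · exact (Fin.succ_ne_zero _ hij.symm).elim
      · exact (Fin.succ_ne_zero _ hij).elim
      · exact hij
    | _ => simp [rename] at h

theorem weaken_injective : Function.Injective (weaken : LExp S V k → LExp S V (k + 1)) :=
  rename_injective (Fin.succ_injective _)

theorem embed_injective : Function.Injective (embed : LExp S V 0 → LExp S V k) :=
  rename_injective (fun i => i.elim0)

@[simp] theorem embed_free (X : V) : (free X : LExp S V 0).embed = (free X : LExp S V k) := rfl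

/-! ### Free variables, c-terms and absence of bound variables -/

theorem FV_rename (e : LExp S V k) (r : Fin k → Fin m) : (e.rename r).FV = e.FV := by
  induction e generalizing m with
  | free X => rfl
  | bound i => rfl
  | app h args ih => simp only [rename, FV, ih]
  | letE e₁ e₂ ih₁ ih₂ => simp only [rename, FV, ih₁, ih₂]

@[simp] theorem FV_weaken (e : LExp S V k) : e.weaken.FV = e.FV := FV_rename ..

@[simp] theorem FV_embed (e : LExp S V 0) : (e.embed : LExp S V k).FV = e.FV := FV_rename ..

theorem FV_subst (e : LExp S V k) (θ : V → LExp S V k) :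
    (e.subst θ).FV = ⋃ X ∈ e.FV, (θ X).FV := by
  induction e with
  | free X => simp [FV]
  | bound i => simp [FV]
  | app h args ih =>
    simp only [app_subst, FV, ih]
    ext Y
    simp only [Set.mem_iUnion]
    grind
  | letE e₁ e₂ ih₁ ih₂ => simp only [letE_subst, FV, ih₁, ih₂, FV_weaken, Set.biUnion_union]

theorem finite_FV (e : LExp S V k) : e.FV.Finite := by
  induction e with
  | free X => exact Set.finite_singleton X
  | bound i => exact Set.finite_empty
  | app h args ih => exact Set.finite_iUnion ih
  | letE e₁ e₂ ih₁ ih₂ => exact ih₁.union ih₂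

theorem isCTerm_app_iff {h : S.Con ⊕ S.Fn} {args : Fin (S.arity h) → LExp S V k} :
    (app h args).IsCTerm ↔ (∃ c, h = Sum.inl c) ∧ ∀ i, (args i).IsCTerm := by
  constructor
  · rintro ⟨⟩
    exact ⟨⟨_, rfl⟩, by assumption⟩
  · rintro ⟨⟨c, rfl⟩, h⟩
    exact .con c args h

theorem not_isCTerm_letE {e₁ : LExp S V k} {e₂ : LExp S V (k + 1)} :
    ¬ (letE e₁ e₂).IsCTerm := by
  rintro ⟨⟩

theorem IsCallOrLet.not_isCTerm {e : LExp S V k} (h : e.IsCallOrLet) : ¬ e.IsCTerm := by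
  rcases h with ⟨f, args, rfl⟩ | ⟨e₁, e₂, rfl⟩
  · simp [isCTerm_app_iff]
  · exact not_isCTerm_letE

theorem isCTerm_rename {e : LExp S V k} {r : Fin k → Fin m} :
    (e.rename r).IsCTerm ↔ e.IsCTerm := by
  induction e generalizing m with
  | free X => exact ⟨fun _ => .free X, fun _ => .free X⟩
  | bound i => exact ⟨fun _ => .bound i, fun _ => .bound (r i)⟩
  | app h args ih => simp only [rename, isCTerm_app_iff, ih]
  | letE e₁ e₂ ih₁ ih₂ => simp [rename, not_isCTerm_letE]

theorem isCTerm_subst {e : LExp S V k} {θ : V → LExp S V k} (hθ : ∀ X, (θ X).IsCTerm) :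
    (e.subst θ).IsCTerm ↔ e.IsCTerm := by
  induction e with
  | free X => exact ⟨fun _ => .free X, fun _ => hθ X⟩
  | bound i => exact Iff.rfl
  | app h args ih => simp only [app_subst, isCTerm_app_iff, ih _ hθ]
  | letE e₁ e₂ ih₁ ih₂ => simp [not_isCTerm_letE]

/-- Only a variable can change its root symbol, and it becomes a c-term. Hence the side condition of
(LetIn) is both preserved and reflected. -/
theorem isCallOrLet_subst {e : LExp S V k} {θ : V → LExp S V k} (hθ : ∀ X, (θ X).IsCTerm) :
    (e.subst θ).IsCallOrLet ↔ e.IsCallOrLet := by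
  cases e with
  | free X => exact ⟨fun h => (h.not_isCTerm (hθ X)).elim, by simp [IsCallOrLet]⟩
  | bound i => exact Iff.rfl
  | app h args => rcases h with c | f <;> simp [IsCallOrLet]
  | letE e₁ e₂ => simp [IsCallOrLet]

/-- A substitution cannot erase a bound variable, so an index missing from the instance is already
missing from `t`. This reflects the side condition of (Elim); a general `r` is needed to pass below
lets. -/
theorem exists_rename_of_subst_eq_rename {t : LExp S V m} {θ : V → LExp S V m}
    {r : Fin k → Fin m} {e : LExp S V k} (h : t.subst θ = e.rename r) :
    ∃ t', t = rename r t' := by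
  induction t generalizing k with
  | free X => exact ⟨free X, rfl⟩
  | bound i =>
    cases e with
    | bound j => exact ⟨bound j, h⟩
    | _ => simp [rename] at h
  | app g args ih =>
    cases e with
    | app g' args' =>
      simp only [app_subst, rename, app.injEq] at h
      obtain ⟨rfl, h⟩ := h
      choose a ha using fun i => ih i (congrFun (eq_of_heq h) i)
      exact ⟨app g a, congrArg (app g) (funext ha)⟩
    | _ => simp [rename] at h
  | letE e₁ e₂ ih₁ ih₂ =>
    cases e with
    | letE e₁' e₂' =>
      simp only [letE_subst, rename, letE.injEq] at h
      obtain ⟨a, rfl⟩ := ih₁ h.1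
      obtain ⟨b, rfl⟩ := ih₂ h.2
      exact ⟨letE a b, rfl⟩
    | _ => simp [rename] at h

theorem noBound_app {h : S.Con ⊕ S.Fn} {args : Fin (S.arity h) → LExp S V k} :
    (app h args).NoBound ↔ ∀ i, (args i).NoBound := by
  constructor
  · rintro ⟨e₀, h₀⟩ i
    cases e₀ with
    | app g a =>
      simp only [embed, rename, app.injEq] at h₀
      obtain ⟨rfl, h₀⟩ := h₀
      exact ⟨a i, congrFun (eq_of_heq h₀) i⟩
    | bound j => exact j.elim0
    | _ => simp [embed, rename] at h₀
  · intro h'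
    choose a ha using h'
    exact ⟨app h a, congrArg (app h) (funext ha)⟩

/-- Bound variables of `s`, or of the value of a variable of `s`, remain visible in the instance.
This lemma and the next carry absence of bound variables over from a unifier to an mgu. -/
theorem IsCTerm.noBound_of_subst {s : LExp S V k} (hs : s.IsCTerm) {θ : V → LExp S V k}
    (h : (s.subst θ).NoBound) : s.NoBound := by
  induction hs with
  | free X => exact ⟨LExp.free X, rfl⟩
  | bound i => exact h
  | con c args _ ih => exact noBound_app.2 fun i => ih i (noBound_app.1 h i)

theorem IsCTerm.noBound_of_mem_FV {s : LExp S V k} (hs : s.IsCTerm) {θ : V → LExp S V k}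
    (h : (s.subst θ).NoBound) {X : V} (hX : X ∈ s.FV) : (θ X).NoBound := by
  induction hs with
  | free Y => obtain rfl : X = Y := hX; exact h
  | bound i => exact hX.elim
  | con c args _ ih =>
    obtain ⟨i, hi⟩ := Set.mem_iUnion.1 hX
    exact ih i (noBound_app.1 h i) hi

theorem NoBound.subst {e : LExp S V k} (he : e.NoBound) {θ : V → LExp S V 0} :
    (e.subst fun X => (θ X).embed).NoBound := by
  obtain ⟨e₀, rfl⟩ := he
  exact ⟨e₀.subst θ, embed_subst ..⟩

/-- With `s` a value of an idempotent `θ`: the variables in the range of `θ` are fixed by `θ`. -/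
theorem IsCTerm.eq_free_of_subst_eq {s : LExp S V k} (hs : s.IsCTerm) {θ : V → LExp S V k}
    (h : s.subst θ = s) {X : V} (hX : X ∈ s.FV) : θ X = LExp.free X := by
  induction hs with
  | free Y => obtain rfl : X = Y := hX; exact h
  | bound i => exact hX.elim
  | con c args _ ih =>
    obtain ⟨i, hi⟩ := Set.mem_iUnion.1 hX
    simp only [app_subst, app.injEq, heq_eq_eq, true_and] at h
    exact ih i (congrFun h i) hi

end LExp

open LExp

/-! ### Contexts under substitution, and locating a redex -/

namespace Ctx

variable {m k : ℕ}

/-- Where a context moves the variables bound by its surroundings. -/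
def shift : {m k : ℕ} → Ctx S V m k → Fin m → Fin k
  | _, _, hole, i => i
  | _, _, app _ _ _ C, i => shift C i
  | _, _, letDef C _, i => shift C i
  | _, _, letBody _ C, i => shift C i.succ

theorem plug_subst (C : Ctx S V m k) (e : LExp S V k) (θ : V → LExp S V m) :
    (C.plug e).subst θ = (C.subst θ).plug (e.subst fun X => (θ X).rename C.shift) := by
  induction C with
  | hole => simp [plug, subst, shift, rename_id]
  | app h args i C ih =>
    simp only [plug, subst, app_subst]
    congr 1
    funext j
    by_cases hj : j = i
    · subst hj; simp [ih]; rfl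
    · simp [hj]
  | letDef C e' ih => simp only [plug, subst, letE_subst, ih]; rfl
  | letBody e' C ih =>
    simp only [plug, subst, letE_subst, ih]
    simp only [weaken, rename_rename]; rfl

theorem plug_subst_embed (C : Ctx S V 0 k) (e : LExp S V k) (θ : V → LExp S V 0) :
    (C.plug e).subst θ = (C.subst θ).plug (e.subst fun X => (θ X).embed) := by
  simp only [plug_subst, rename_eq_embed]

theorem subst_subst (C : Ctx S V m k) (θ τ : V → LExp S V m) :
    (C.subst θ).subst τ = C.subst fun X => (θ X).subst τ := by
  induction C with
  | hole => rfl
  | app h args i C ih => simp only [subst, ih, LExp.subst_subst]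
  | letDef C e ih => simp only [subst, ih, LExp.subst_subst, weaken_subst]
  | letBody e C ih => simp only [subst, ih, LExp.subst_subst, weaken_subst]

/-- The entry of `args` at the hole is overwritten, so its variables must not count. The variables
of `C.plug s` include all that matter, and `s'` may differ from `s` because a redex gets replaced by
its contractum. -/
theorem subst_plug_congr (C : Ctx S V m k) (s s' : LExp S V k) {θ τ : V → LExp S V m}
    (h : ∀ X ∈ (C.plug s).FV, θ X = τ X) : (C.subst θ).plug s' = (C.subst τ).plug s' := by
  induction C with
  | hole => rfl
  | app g args i C ih =>
    simp only [plug, FV, Set.mem_iUnion] at h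
    simp only [plug, subst]
    congr 1
    funext j
    by_cases hj : j = i
    · subst hj
      simpa using ih s s' fun X hX => h X ⟨j, by simpa using hX⟩
    · simp only [Function.update_of_ne hj]
      exact subst_congr fun X hX => h X ⟨j, by simpa [hj] using hX⟩
  | letDef C e ih =>
    simp only [plug, subst]
    rw [ih s s' fun X hX => h X (Or.inl hX), subst_congr fun X hX => by rw [h X (Or.inr hX)]]
  | letBody e C ih =>
    simp only [plug, subst]
    rw [ih s s' fun X hX => by rw [h X (Or.inr hX)], subst_congr fun X hX => h X (Or.inl hX)]

theorem FV_subset_FV_plug (C : Ctx S V m k) (s : LExp S V k) : s.FV ⊆ (C.plug s).FV := by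
  induction C with
  | hole => exact subset_rfl
  | app g args i C ih =>
    exact fun X hX => Set.mem_iUnion.2 ⟨i, by simpa using ih s hX⟩
  | letDef C e ih => exact (ih s).trans Set.subset_union_left
  | letBody e C ih => exact (ih s).trans Set.subset_union_right

theorem isCTerm_of_plug (C : Ctx S V m k) (s : LExp S V k) (h : (C.plug s).IsCTerm) :
    s.IsCTerm := by
  induction C with
  | hole => exact h
  | app g args i C ih => exact ih s (by simpa using (isCTerm_app_iff.1 h).2 i)
  | letDef C e ih => exact (not_isCTerm_letE h).elim
  | letBody e C ih => exact (not_isCTerm_letE h).elim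

/-- Subexpressions of c-terms are c-terms, so a non-c-term cannot sit inside a value of `θ`, and the
path to the hole exists in `e`. The contexts are compared only after plugging, since their
overwritten entries may differ. -/
theorem exists_plug_of_subst_eq_plug (C : Ctx S V m k) {r : LExp S V k} (hr : ¬ r.IsCTerm)
    {e : LExp S V m} {θ : V → LExp S V m} (hθ : ∀ X, (θ X).IsCTerm)
    (h : e.subst θ = C.plug r) :
    ∃ (D : Ctx S V m k) (t : LExp S V k), e = D.plug t ∧
      (t.subst fun X => (θ X).rename D.shift) = r ∧
      ∀ s, (D.subst θ).plug s = C.plug s := by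
  have hn : ¬ (e.subst θ).IsCTerm := fun hc => hr (isCTerm_of_plug C r (h ▸ hc))
  induction C with
  | hole =>
    refine ⟨hole, e, rfl, ?_, fun s => rfl⟩
    simpa only [shift, rename_id, plug] using h
  | app g args i C ih =>
    cases e with
    | free X => exact (hn (hθ X)).elim
    | bound i => exact (hn (.bound i)).elim
    | letE e₁ e₂ => simp [plug] at h
    | app g' args' =>
      simp only [app_subst, plug, LExp.app.injEq] at h
      obtain ⟨rfl, h⟩ := h
      replace h := congrFun (eq_of_heq h)
      have hi : (args' i).subst θ = C.plug r := by simpa using h i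
      obtain ⟨D, t, h₁, h₂, h₃⟩ := ih hr hθ hi fun hc => hr (isCTerm_of_plug C r (hi ▸ hc))
      refine ⟨app g' args' i D, t, ?_, h₂, fun s => ?_⟩
      · simp [plug, ← h₁]
      · simp only [plug, subst, h₃]
        congr 1
        funext j
        by_cases hj : j = i
        · subst hj; simp
        · simpa [hj] using h j
  | letDef C e' ih =>
    cases e with
    | free X => exact (hn (hθ X)).elim
    | bound i => exact (hn (.bound i)).elim
    | app => simp [plug] at h
    | letE e₁ e₂ =>
      simp only [letE_subst, plug, letE.injEq] at h
      obtain ⟨D, t, rfl, h₂, h₃⟩ := ih hr hθ h.1 fun hc => hr (isCTerm_of_plug C r (h.1 ▸ hc))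
      exact ⟨letDef D e₂, t, rfl, h₂, fun s => by simp only [plug, subst, h₃, h.2]⟩
  | letBody e' C ih =>
    cases e with
    | free X => exact (hn (hθ X)).elim
    | bound i => exact (hn (.bound i)).elim
    | app => simp [plug] at h
    | letE e₁ e₂ =>
      simp only [letE_subst, plug, letE.injEq] at h
      obtain ⟨D, t, rfl, h₂, h₃⟩ := ih hr (fun X => isCTerm_rename.2 (hθ X)) h.2
        fun hc => hr (isCTerm_of_plug C r (h.2 ▸ hc))
      refine ⟨letBody e₁ D, t, rfl, ?_, fun s => ?_⟩
      · rw [← h₂]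
        simp only [rename_rename]; rfl
      · rw [← h.1]
        exact congrArg _ (h₃ s)

end Ctx

/-! ### Soundness: let-rewriting under substitution -/

section Soundness

variable {k : ℕ} {P : Set (Rule S V)}

theorem isCSubst_free : IsCSubst (free : V → LExp S V k) :=
  ⟨by simp [IsSubst], fun X => .free X⟩

theorem IsCSubst.comp {θ τ : V → LExp S V k} (hθ : IsCSubst θ) (hτ : IsCSubst τ) :
    IsCSubst fun X => (θ X).subst τ := by
  refine ⟨(hθ.1.union hτ.1).subset fun X hX => ?_, fun X => (isCTerm_subst hτ.2).2 (hθ.2 X)⟩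
  by_contra h
  simp only [Set.mem_union, Set.mem_ofPred_eq, not_or, not_not] at h hX
  exact hX (by rw [h.1, free_subst, h.2])

theorem embed_eq_free {e : LExp S V 0} {X : V} :
    (e.embed : LExp S V k) = free X ↔ e = free X :=
  ⟨fun h => embed_injective (h.trans (embed_free X).symm), fun h => h ▸ embed_free X⟩

theorem IsCSubst.embed {θ : V → LExp S V 0} (hθ : IsCSubst θ) :
    IsCSubst fun X => ((θ X).embed : LExp S V k) :=
  ⟨hθ.1.subset fun _ hX h => hX (embed_eq_free.2 h), fun X => isCTerm_rename.2 (hθ.2 X)⟩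

theorem weaken_subst_eq_rename {m : ℕ} (e : LExp S V (k + 1)) (r : Fin (k + 1) → Fin m)
    (θ : V → LExp S V k) :
    (e.subst fun X => (θ X).weaken).rename r =
      (e.rename r).subst fun X => (θ X).rename fun i => r i.succ := by
  simp only [← rename_rename, ← rename_subst]
  simp only [weaken, rename_rename]

theorem letIn_subst (g : S.Con ⊕ S.Fn) (args : Fin (S.arity g) → LExp S V k)
    (i : Fin (S.arity g)) (θ : V → LExp S V k) :
    (letE (args i)
      (app g (Function.update (fun j => (args j).weaken) i (bound 0)))).subst θ =
      letE ((args i).subst θ)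
        (app g (Function.update (fun j => ((args j).subst θ).weaken) i (bound 0))) := by
  simp only [letE_subst, app_subst]
  congr 2
  funext j
  by_cases hj : j = i
  · subst hj; simp
  · simp only [Function.update_of_ne hj, weaken_subst]

theorem LetRule.subst {e e' : LExp S V k} (h : LetRule e e') {θ : V → LExp S V k}
    (hθ : ∀ X, (θ X).IsCTerm) : LetRule (e.subst θ) (e'.subst θ) := by
  cases h with
  | letIn g args i hi =>
    rw [letIn_subst]
    exact .letIn g _ i ((isCallOrLet_subst hθ).2 hi)
  | bind t b ht =>
    rw [letE_subst, ← instantiate_subst]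
    exact .bind _ _ ((isCTerm_subst hθ).2 ht)
  | elim a b =>
    rw [letE_subst, weaken_subst]
    exact .elim _ _
  | flat a b c =>
    simp only [letE_subst]
    convert LetRule.flat _ _ _ using 3
    rw [weaken_subst_eq_rename]
    simp only [weaken, rename_rename]; rfl

/-- A left-hand side of a let rule is not a c-term, so variables of `t` cannot produce the structure
it requires; `t` has that structure itself. -/
theorem LetRule.of_subst {t r : LExp S V k} {θ : V → LExp S V k}
    (hθ : ∀ X, (θ X).IsCTerm) (h : LetRule (t.subst θ) r) :
    ∃ t', LetRule t t' ∧ t'.subst θ = r := by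
  -- The instance is generalized to a variable, so that case analysis on the rule can unify its
  -- index.
  suffices H : ∀ s, s = t.subst θ → LetRule s r → ∃ t', LetRule t t' ∧ t'.subst θ = r from
    H _ rfl h
  clear h
  intro s hs h
  cases h with
  | letIn g args i hi =>
    cases t with
    | free X =>
      exact (hi.not_isCTerm ((isCTerm_app_iff.1 (hs ▸ hθ X : (app g args).IsCTerm)).2 i)).elim
    | bound i => simp at hs
    | letE => simp at hs
    | app g' args' =>
      simp only [app_subst, app.injEq] at hs
      obtain ⟨rfl, hs⟩ := hs
      obtain rfl := eq_of_heq hs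
      refine ⟨_, .letIn g args' i ((isCallOrLet_subst hθ).1 hi), letIn_subst ..⟩
  | bind a b ha =>
    cases t with
    | free X => exact (not_isCTerm_letE (hs ▸ hθ X : (letE a b).IsCTerm)).elim
    | bound i => simp at hs
    | app => simp at hs
    | letE e₁ e₂ =>
      simp only [letE_subst, letE.injEq] at hs
      obtain ⟨rfl, rfl⟩ := hs
      exact ⟨_, .bind _ _ ((isCTerm_subst hθ).1 ha), (instantiate_subst ..).symm⟩
  | elim a b =>
    cases t with
    | free X => exact (not_isCTerm_letE (hs ▸ hθ X : (letE a r.weaken).IsCTerm)).elim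
    | bound i => simp at hs
    | app => simp at hs
    | letE e₁ e₂ =>
      simp only [letE_subst, letE.injEq] at hs
      obtain ⟨rfl, hs⟩ := hs
      obtain ⟨c, rfl⟩ := exists_rename_of_subst_eq_rename hs.symm
      exact ⟨c, .elim _ _, weaken_injective (((weaken_subst ..).symm.trans hs.symm))⟩
  | flat a b c =>
    cases t with
    | free X => exact (not_isCTerm_letE (hs ▸ hθ X : (letE (letE a b) c).IsCTerm)).elim
    | bound i => simp at hs
    | app => simp at hs
    | letE e₁ e₂ =>
      simp only [letE_subst, letE.injEq] at hs
      obtain ⟨hs, rfl⟩ := hs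
      cases e₁ with
      | free X => exact (not_isCTerm_letE (hs ▸ hθ X : (letE a b).IsCTerm)).elim
      | bound i => simp at hs
      | app => simp at hs
      | letE e₁ e₃ =>
        simp only [letE_subst, letE.injEq] at hs
        obtain ⟨rfl, rfl⟩ := hs
        refine ⟨_, .flat _ _ _, ?_⟩
        simp only [letE_subst, weaken_subst_eq_rename]
        simp only [weaken, rename_rename]; rfl

theorem LetRule.not_isCTerm {e e' : LExp S V k} (h : LetRule e e') : ¬ e.IsCTerm := by
  cases h with
  | letIn g args i hi => exact fun hc => hi.not_isCTerm ((isCTerm_app_iff.1 hc).2 i)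
  | _ => exact not_isCTerm_letE

/-- The matching substitution of (Fapp) is composed with `θ`. Values of `θ` come from outside the
context and mention none of its bound variables, so the condition on extra variables survives. -/
theorem LetRw.subst {e e' : LExp S V 0} (h : LetRw P e e') {θ : V → LExp S V 0}
    (hθ : IsCSubst θ) : LetRw P (e.subst θ) (e'.subst θ) := by
  cases h with
  | letRule C h =>
    simp only [Ctx.plug_subst_embed]
    exact .letRule _ (h.subst hθ.embed.2)
  | fapp C R hR τ hτ hExtra =>
    simp only [Ctx.plug_subst_embed, app_subst, LExp.subst_subst]
    exact .fapp _ R hR _ (hτ.comp hθ.embed) fun X hX => (hExtra X hX).subst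

theorem LetRw.reflTransGen_subst {e e' : LExp S V 0} (h : Relation.ReflTransGen (LetRw P) e e')
    {θ : V → LExp S V 0} (hθ : IsCSubst θ) :
    Relation.ReflTransGen (LetRw P) (e.subst θ) (e'.subst θ) :=
  h.lift (fun e => e.subst θ) fun _ _ h => h.subst hθ

theorem mem_FV_perm {e : LExp S V k} (ρ : Equiv.Perm V) {X : V} :
    ρ X ∈ (e.subst fun X => free (ρ X)).FV ↔ X ∈ e.FV := by
  simp [FV_subst, FV]

theorem mem_variantPats (R : Rule S V) (ρ : Equiv.Perm V) {X : V} :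
    ρ X ∈ tupleVars (R.variantPats ρ) ↔ X ∈ tupleVars R.pats := by
  simp only [tupleVars, Set.mem_iUnion, Rule.variantPats, mem_FV_perm]

theorem mem_variantRhs (R : Rule S V) (ρ : Equiv.Perm V) {X : V} :
    ρ X ∈ (R.variantRhs ρ).FV ↔ X ∈ R.rhs.FV :=
  mem_FV_perm ρ

theorem embed_perm_subst (e : LExp S V 0) (ρ : Equiv.Perm V) (θ : V → LExp S V k) :
    ((e.subst fun X => free (ρ X)).embed : LExp S V k).subst θ =
      e.embed.subst fun X => θ (ρ X) := by
  rw [← embed_subst, LExp.subst_subst]; rfl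

theorem finite_tupleVars {n : ℕ} (t : Fin n → LExp S V k) : (tupleVars t).Finite :=
  Set.finite_iUnion fun i => (t i).finite_FV

theorem LetNarr.sound {Q : Prop} {e e' : LExp S V 0} {σ : V → LExp S V 0}
    (h : LetNarr P Q e σ e') : IsCSubst σ ∧ LetRw P (e.subst σ) e' := by
  classical
  cases h with
  | letRule C h =>
    refine ⟨isCSubst_free, ?_⟩
    rw [subst_free]
    exact .letRule C h
  | narr C R hR ρ t hfresh θ hθ hunif hmgu σ hσ hσp =>
    have hσc : IsCSubst σ := by
      refine ⟨hθ.1.subset fun X hX h => ?_, fun X => ?_⟩ <;>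
        by_cases hp : X ∈ tupleVars (R.variantPats ρ)
      · exact hX (hσp X hp)
      · rw [hσ X hp, embed_eq_free] at h
        exact hX h
      · rw [hσp X hp]
        exact .free X
      · have := hθ.2 X
        rwa [hσ X hp, LExp.embed, isCTerm_rename] at this
    refine ⟨hσc, ?_⟩
    rw [Ctx.plug_subst_embed, app_subst]
    set A := tupleVars R.pats ∪ R.rhs.FV with hA
    -- The cut-off to the rule's variables keeps the domain finite: `ρ` may move infinitely many
    -- variables.
    let τ : V → LExp S V _ := fun X => if X ∈ A then θ (ρ X) else free X
    have hτA : ∀ X ∈ A, τ X = θ (ρ X) := fun X hX => if_pos hX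
    have hτ : IsCSubst τ := by
      refine ⟨((finite_tupleVars R.pats).union (finite_FV R.rhs)).subset fun X hX => ?_, fun X => ?_⟩
      · by_contra h
        exact hX (if_neg h)
      · by_cases h : X ∈ A
        · rw [hτA X h]; exact hθ.2 _
        · simp only [τ, if_neg h]; exact .free X
    have hr : (R.variantRhs ρ).embed.subst θ = R.rhs.embed.subst τ := by
      rw [Rule.variantRhs, embed_perm_subst]
      refine subst_congr fun X hX => (hτA X (Or.inr ?_)).symm
      rwa [FV_embed] at hX
    -- By freshness no variable of `t` is a pattern variable, so `σ` and `θ` agree on `t`.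
    have hp : ∀ i, (t i).subst (fun X => (σ X).embed) = (R.pats i).embed.subst τ := by
      intro i
      rw [subst_congr (τ := θ), hunif i]
      · simp only [Rule.variantPats, embed_perm_subst]
        refine subst_congr fun X hX => (hτA X (Or.inl (Set.mem_iUnion.2 ⟨i, ?_⟩))).symm
        rwa [FV_embed] at hX
      · intro X hX
        refine (hσ X fun hX' => Set.disjoint_left.1 hfresh (Or.inl hX') ?_).symm
        exact C.FV_subset_FV_plug _ (Set.mem_iUnion.2 ⟨i, hX⟩)
    rw [hr]
    simp only [hp]
    refine .fapp _ R hR τ hτ fun X hX => ?_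
    by_cases h : X ∈ A
    · rw [hτA X h, hσ _ (mt (mem_variantPats R ρ).1 hX)]
      exact ⟨_, rfl⟩
    · simp only [τ, if_neg h]
      exact ⟨free X, rfl⟩

theorem LetNarrStar.sound {Q : Prop} {e e' : LExp S V 0} {σ : V → LExp S V 0}
    (h : LetNarrStar P Q e σ e') :
    IsCSubst σ ∧ Relation.ReflTransGen (LetRw P) (e.subst σ) e' := by
  induction h with
  | refl e => exact ⟨isCSubst_free, by rw [subst_free]⟩
  | head h hs ih =>
    refine ⟨h.sound.1.comp ih.1, ?_⟩
    rw [← LExp.subst_subst]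
    exact .head (h.sound.2.subst ih.1) ih.2

theorem LetNarr.mono {Q Q' : Prop} (hQ : Q' → Q) {e e' : LExp S V 0} {σ : V → LExp S V 0}
    (h : LetNarr P Q e σ e') : LetNarr P Q' e σ e' := by
  cases h with
  | letRule C h => exact .letRule C h
  | narr C R hR ρ t hfresh θ hθ hunif hmgu σ hσ hσp =>
    exact .narr C R hR ρ t hfresh θ hθ hunif (fun q => hmgu (hQ q)) σ hσ hσp

theorem LetNarrStar.mono {Q Q' : Prop} (hQ : Q' → Q) {e e' : LExp S V 0} {σ : V → LExp S V 0}
    (h : LetNarrStar P Q e σ e') : LetNarrStar P Q' e σ e' := by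
  induction h with
  | refl e => exact .refl e
  | head h _ ih => exact .head (h.mono hQ) ih

end Soundness

/-! ### Existence of standard mgus of c-terms, bound variables being constants -/

section Unification

variable {k n : ℕ}

namespace LExp

/-- The number of nodes of an expression. -/
def size : {k : ℕ} → LExp S V k → ℕ
  | _, free _ => 1
  | _, bound _ => 1
  | _, app _ args => 1 + ∑ i, size (args i)
  | _, letE e₁ e₂ => 1 + size e₁ + size e₂

theorem IsCTerm.size_le_of_mem_FV {s : LExp S V k} (hs : s.IsCTerm) {X : V} (hX : X ∈ s.FV)
    (τ : V → LExp S V k) : (τ X).size ≤ (s.subst τ).size := by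
  induction hs with
  | free Y => obtain rfl : X = Y := hX; exact le_rfl
  | bound i => exact hX.elim
  | con c args _ ih =>
    obtain ⟨i, hi⟩ := Set.mem_iUnion.1 hX
    have := Finset.single_le_sum (f := fun i => ((args i).subst τ).size)
      (fun _ _ => Nat.zero_le _) (Finset.mem_univ i)
    have := ih i hi
    simp only [app_subst, size] at *
    omega

/-- The occurs check. -/
theorem IsCTerm.not_mem_FV_of_eq {s : LExp S V k} (hs : s.IsCTerm) {X : V} (hne : s ≠ LExp.free X)
    {τ : V → LExp S V k} (h : τ X = s.subst τ) : X ∉ s.FV := by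
  intro hX
  cases hs with
  | free Y => obtain rfl : X = Y := hX; exact hne rfl
  | bound i => exact hX.elim
  | con c args hc =>
    obtain ⟨i, hi⟩ := Set.mem_iUnion.1 hX
    have h₁ := (hc i).size_le_of_mem_FV hi τ
    have h₂ := Finset.single_le_sum (f := fun i => ((args i).subst τ).size)
      (fun _ _ => Nat.zero_le _) (Finset.mem_univ i)
    have h₃ := congrArg size h
    simp only [app_subst, size] at *
    omega

/-- Two distinct unifiable c-terms disagree at a variable of one of them. -/
theorem IsCTerm.exists_disagreement {a b : LExp S V k} (ha : a.IsCTerm) (hb : b.IsCTerm)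
    (hne : a ≠ b) {τ₀ : V → LExp S V k} (h₀ : a.subst τ₀ = b.subst τ₀) :
    ∃ X s, s.IsCTerm ∧ s ≠ LExp.free X ∧ X ∈ a.FV ∪ b.FV ∧ s.FV ⊆ a.FV ∪ b.FV ∧
      ∀ τ : V → LExp S V k, a.subst τ = b.subst τ → τ X = s.subst τ := by
  induction ha generalizing b with
  | free X =>
    exact ⟨X, b, hb, hne.symm, Or.inl rfl, Set.subset_union_right, fun τ h => h⟩
  | bound i =>
    cases hb with
    | free Y =>
      exact ⟨Y, LExp.bound i, .bound i, hne, Or.inr rfl, Set.subset_union_left, fun τ h => h.symm⟩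
    | bound j => exact (hne h₀).elim
    | con => simp at h₀
  | con c args hc ih =>
    cases hb with
    | free Y =>
      exact ⟨Y, _, .con c args hc, hne, Or.inr rfl, Set.subset_union_left, fun τ h => h.symm⟩
    | bound j => simp at h₀
    | con c' args' hc' =>
      simp only [app_subst, app.injEq, Sum.inl.injEq] at h₀
      obtain ⟨rfl, h₀⟩ := h₀
      obtain ⟨i, hi⟩ : ∃ i, args i ≠ args' i := by
        by_contra! h
        exact hne (by rw [funext h])
      obtain ⟨X, s, h₁, h₂, h₃, h₄, h₅⟩ := ih i (hc' i) hi (congrFun (eq_of_heq h₀) i)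
      have hsub : (args i).FV ∪ (args' i).FV ⊆
          (app (Sum.inl c) args).FV ∪ (app (Sum.inl c) args').FV :=
        Set.union_subset_union (Set.subset_iUnion (fun i => (args i).FV) i)
          (Set.subset_iUnion (fun i => (args' i).FV) i)
      refine ⟨X, s, h₁, h₂, hsub h₃, h₄.trans hsub, fun τ h => h₅ τ ?_⟩
      simp only [app_subst, app.injEq, heq_eq_eq, true_and] at h
      exact congrFun h i

end LExp

/-- `δ` is an idempotent c-substitution on the variables of `t` and `p` that is at least as
general as every unifier of `t` and `p`. -/
structure IsPreMGU (t p : Fin n → LExp S V k) (δ : V → LExp S V k) : Prop where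
  isCTerm : ∀ X, (δ X).IsCTerm
  idem : ∀ X, (δ X).subst δ = δ X
  dom : ∀ X, δ X ≠ free X → X ∈ tupleVars t ∪ tupleVars p
  range : ∀ X, X ∈ tupleVars t ∪ tupleVars p → (δ X).FV ⊆ tupleVars t ∪ tupleVars p
  general : ∀ τ : V → LExp S V k, IsUnifier t p τ → ∀ X, (δ X).subst τ = τ X

/-- One unification step: `δ` is followed by `[X/s]`, where `X` and `s` come from a disagreement
that every unifier has to resolve. -/
theorem IsPreMGU.extend {t p : Fin n → LExp S V k} {δ : V → LExp S V k} (hδ : IsPreMGU t p δ)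
    (ht : ∀ i, (t i).IsCTerm) (hp : ∀ i, (p i).IsCTerm)
    {τ₀ : V → LExp S V k} (h₀ : IsUnifier t p τ₀) (hn : ¬ IsUnifier t p δ) :
    ∃ δ', IsPreMGU t p δ' ∧ {X | δ X ≠ free X} ⊂ {X | δ' X ≠ free X} := by
  classical
  -- Unifiers absorb `δ`, so they also unify the `δ`-instances.
  have hunif : ∀ τ, IsUnifier t p τ → ∀ i, ((t i).subst δ).subst τ = ((p i).subst δ).subst τ := by
    intro τ hτ i
    simp only [LExp.subst_subst, hδ.general τ hτ]
    exact hτ i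
  obtain ⟨i, hi⟩ := not_forall.1 hn
  obtain ⟨X, s, hs, hsX, hX, hsFV, hgen⟩ := IsCTerm.exists_disagreement
    ((isCTerm_subst hδ.isCTerm).2 (ht i)) ((isCTerm_subst hδ.isCTerm).2 (hp i)) hi (hunif τ₀ h₀ i)
  have hXs : X ∉ s.FV := hs.not_mem_FV_of_eq hsX (hgen τ₀ (hunif τ₀ h₀ i))
  have hvars : ∀ Y ∈ ((t i).subst δ).FV ∪ ((p i).subst δ).FV,
      δ Y = free Y ∧ Y ∈ tupleVars t ∪ tupleVars p := by
    intro Y hY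
    simp only [FV_subst, Set.mem_union, Set.mem_iUnion, exists_prop] at hY
    obtain ⟨Z, hZ, hYZ⟩ : ∃ Z, Z ∈ tupleVars t ∪ tupleVars p ∧ Y ∈ (δ Z).FV := by
      rcases hY with ⟨Z, hZ, h⟩ | ⟨Z, hZ, h⟩
      · exact ⟨Z, Or.inl (Set.mem_iUnion.2 ⟨i, hZ⟩), h⟩
      · exact ⟨Z, Or.inr (Set.mem_iUnion.2 ⟨i, hZ⟩), h⟩
    exact ⟨(hδ.isCTerm Z).eq_free_of_subst_eq (hδ.idem Z) hYZ, hδ.range Z hZ hYZ⟩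
  let η : V → LExp S V k := Function.update free X s
  have hηX : η X = s := Function.update_self ..
  have hη : ∀ Y, Y ≠ X → η Y = free Y := fun Y hY => Function.update_of_ne hY ..
  have hηc : ∀ Y, (η Y).IsCTerm := by
    intro Y
    by_cases hY : Y = X
    · rw [hY, hηX]; exact hs
    · rw [hη Y hY]; exact .free Y
  have hδX : (δ X).subst η = s := by rw [(hvars X hX).1, free_subst, hηX]
  have hfix : ∀ Y ∈ s.FV, (δ Y).subst η = free Y := fun Y hY => by
    rw [(hvars Y (hsFV hY)).1, free_subst, hη Y (by rintro rfl; exact hXs hY)]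
  refine ⟨fun Y => (δ Y).subst η, ⟨fun Y => (isCTerm_subst hηc).2 (hδ.isCTerm Y), fun Y => ?_,
    fun Y hY => ?_, fun Y hY Z hZ => ?_, fun τ hτ Y => ?_⟩, ?_⟩
  · rw [LExp.subst_subst]
    refine subst_congr fun Z hZ => ?_
    by_cases hZX : Z = X
    · rw [hZX, hηX, subst_congr (τ := free) hfix, subst_free]
    · rw [hη Z hZX, free_subst, (hδ.isCTerm Y).eq_free_of_subst_eq (hδ.idem Y) hZ, free_subst,
        hη Z hZX]
  · by_cases hYX : Y = X
    · rw [hYX]; exact (hvars X hX).2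
    · refine hδ.dom Y fun h => hY ?_
      simp only [h, free_subst, hη Y hYX]
  · simp only [FV_subst, Set.mem_iUnion, exists_prop] at hZ
    obtain ⟨W, hW, hZ⟩ := hZ
    by_cases hWX : W = X
    · rw [hWX, hηX] at hZ
      exact (hvars Z (hsFV hZ)).2
    · rw [hη W hWX] at hZ
      obtain rfl : Z = W := hZ
      exact hδ.range Y hY hW
  · rw [LExp.subst_subst, ← hδ.general τ hτ Y]
    refine subst_congr fun Z _ => ?_
    by_cases hZX : Z = X
    · rw [hZX, hηX, ← hgen τ (hunif τ hτ i)]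
    · rw [hη Z hZX, free_subst]
  -- Were a `Y` of the old domain fixed now, it would occur in `s` or in the range of `δ`, and `δ`
  -- fixes those variables. The variable `X` is new in the domain because `s` is not `X`.
  · refine ⟨fun Y hY h => hY ?_, fun h => h (a := X) ?_ (hvars X hX).1⟩
    · have hY' : Y ∈ ((δ Y).subst η).FV := (congrArg (Y ∈ FV ·) h).mpr rfl
      simp only [FV_subst, Set.mem_iUnion, exists_prop] at hY'
      obtain ⟨W, hW, hYW⟩ := hY'
      by_cases hWX : W = X
      · rw [hWX, hηX] at hYW
        exact (hvars Y (hsFV hYW)).1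
      · rw [hη W hWX] at hYW
        obtain rfl : Y = W := hYW
        exact (hδ.isCTerm Y).eq_free_of_subst_eq (hδ.idem Y) hW
    · simpa only [Set.mem_ofPred_eq, hδX] using hsX

/-- Otherwise `IsPreMGU.extend` could be iterated forever, although every domain lies in the finite
set of variables of `t` and `p`. -/
theorem exists_isPreMGU_isUnifier {t p : Fin n → LExp S V k}
    (ht : ∀ i, (t i).IsCTerm) (hp : ∀ i, (p i).IsCTerm)
    {τ₀ : V → LExp S V k} (h₀ : IsUnifier t p τ₀) : ∃ δ, IsPreMGU t p δ ∧ IsUnifier t p δ := by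
  by_contra! H
  have hfin : (tupleVars t ∪ tupleVars p).Finite := (finite_tupleVars t).union (finite_tupleVars p)
  have hdom : ∀ δ, IsPreMGU t p δ → {X | δ X ≠ free X} ⊆ tupleVars t ∪ tupleVars p :=
    fun δ hδ X hX => hδ.dom X hX
  have hbig : ∀ N : ℕ, ∃ δ, IsPreMGU t p δ ∧ N ≤ {X | δ X ≠ free X}.ncard := by
    intro N
    induction N with
    | zero =>
      exact ⟨free, ⟨.free, fun X => rfl, fun X h => (h rfl).elim,
        fun X hX => Set.singleton_subset_iff.2 hX, fun τ _ X => rfl⟩, Nat.zero_le _⟩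
    | succ N ih =>
      obtain ⟨δ, hδ, hN⟩ := ih
      obtain ⟨δ', hδ', hlt⟩ := hδ.extend ht hp h₀ (H δ hδ)
      exact ⟨δ', hδ', hN.trans_lt (Set.ncard_lt_ncard hlt (hfin.subset (hdom δ' hδ')))⟩
  obtain ⟨δ, hδ, hN⟩ := hbig ((tupleVars t ∪ tupleVars p).ncard + 1)
  have := Set.ncard_le_ncard (hdom δ hδ) hfin
  omega

theorem IsPreMGU.isStandardMGU {t p : Fin n → LExp S V k} {δ : V → LExp S V k}
    (hδ : IsPreMGU t p δ) (h : IsUnifier t p δ) : IsStandardMGU t p δ :=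
  ⟨h, fun τ hτ hu => ⟨τ, hτ, fun X => (hδ.general τ hu X).symm⟩, hδ.idem,
    fun X hX => ⟨hδ.dom X hX, hδ.range X (hδ.dom X hX)⟩⟩

theorem IsPreMGU.isCSubst {t p : Fin n → LExp S V k} {δ : V → LExp S V k}
    (hδ : IsPreMGU t p δ) : IsCSubst δ :=
  ⟨((finite_tupleVars t).union (finite_tupleVars p)).subset hδ.dom, hδ.isCTerm⟩

end Unification

theorem exists_perm_forall_mem_notMem {α : Type*} [Infinite α] {A B : Set α} (hA : A.Finite)
    (hB : B.Finite) : ∃ ρ : Equiv.Perm α, ∀ a ∈ A, ρ a ∉ B := by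
  classical
  induction A, hA using Set.Finite.induction_on with
  | empty => exact ⟨1, by simp⟩
  | @insert a A ha hA ih =>
    obtain ⟨ρ, hρ⟩ := ih
    -- Avoiding the image of `A` as well ensures that the swap leaves the earlier choices intact.
    obtain ⟨c, hc⟩ := (hB.union (hA.image ρ)).exists_notMem
    refine ⟨Equiv.swap (ρ a) c * ρ, fun x hx => ?_⟩
    rcases hx with rfl | hx
    · simpa using fun h => hc (Or.inl h)
    · have h₁ : ρ x ≠ ρ a := fun h => ha (ρ.injective h ▸ hx)
      have h₂ : ρ x ≠ c := fun h => hc (Or.inr ⟨x, hx, h⟩)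
      simpa [Equiv.swap_apply_of_ne_of_ne h₁ h₂] using hρ x hx

/-! ### Completeness: lifting rewriting to narrowing -/

section Completeness

variable {P : Set (Rule S V)} [Infinite V]

/-- The mgu `δ` of `ts` and the renamed patterns satisfies `δμ = μ` for the unifier `μ` of the
rewriting step. Since `μ` has no bound variables outside the pattern variables, `δ` has none there
either, and `σ` and `θ'` can be read off at level `0`. -/
theorem LetNarr.lift_fapp {k : ℕ} (C : Ctx S V 0 k) {R : Rule S V} (hR : R ∈ P)
    {ts : Fin (S.arity (Sum.inr R.f)) → LExp S V k} {θ : V → LExp S V 0} (hθ : IsCSubst θ)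
    {τ : V → LExp S V k} (hτ : IsCSubst τ)
    (hExtra : ∀ X, X ∉ tupleVars R.pats → (τ X).NoBound)
    (hts : ∀ i, (ts i).subst (fun X => (θ X).embed) = (R.pats i).embed.subst τ)
    {W : Set V} (hW : W.Finite) :
    ∃ σ e₂ θ', LetNarr P True (C.plug (app (Sum.inr R.f) ts)) σ e₂ ∧ IsCSubst θ' ∧
      (∀ X ∈ W, (σ X).subst θ' = θ X) ∧
      e₂.subst θ' = (C.subst θ).plug (R.rhs.embed.subst τ) := by
  classical
  set e := C.plug (app (Sum.inr R.f) ts) with he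
  set A := tupleVars R.pats ∪ R.rhs.FV with hA
  have hAfin : A.Finite := (finite_tupleVars _).union (finite_FV _)
  obtain ⟨ρ, hρ⟩ := exists_perm_forall_mem_notMem hAfin (hW.union e.finite_FV)
  set q : Fin (S.arity (Sum.inr R.f)) → LExp S V k := fun i => (R.variantPats ρ i).embed with hq
  have hqvars : tupleVars q = tupleVars (R.variantPats ρ) := by
    simp only [tupleVars, hq, FV_embed]
  have hPv : ∀ X ∈ tupleVars (R.variantPats ρ), ρ.symm X ∈ tupleVars R.pats := by
    intro X hX
    rwa [← mem_variantPats R ρ, ρ.apply_symm_apply]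
  have hPvB : ∀ X ∈ W ∪ e.FV, X ∉ tupleVars (R.variantPats ρ) := by
    intro X hX hX'
    have := hρ _ (Or.inl (hPv X hX'))
    rw [ρ.apply_symm_apply] at this
    exact this hX
  have htse : ∀ i, (ts i).FV ⊆ e.FV := fun i X hX =>
    C.FV_subset_FV_plug _ (Set.mem_iUnion.2 ⟨i, hX⟩)
  -- the unifier given by the rewriting step
  let μ : V → LExp S V k := fun Y => if ρ.symm Y ∈ A then τ (ρ.symm Y) else (θ Y).embed
  have hμA : ∀ X ∈ A, μ (ρ X) = τ X := fun X hX => by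
    simp only [μ, ρ.symm_apply_apply, if_pos hX]
  have hμB : ∀ X ∈ W ∪ e.FV, μ X = (θ X).embed := fun X hX =>
    if_neg fun h => hρ _ h (by rwa [ρ.apply_symm_apply])
  have hμc : ∀ X, (μ X).IsCTerm := by
    intro X
    by_cases h : ρ.symm X ∈ A
    · simp only [μ, if_pos h]; exact hτ.2 _
    · simp only [μ, if_neg h]; exact hθ.embed.2 _
  have hμfin : {X | μ X ≠ free X}.Finite := by
    refine ((hAfin.image ρ).union hθ.1).subset fun X hX => ?_
    by_cases h : ρ.symm X ∈ A
    · exact Or.inl ⟨_, h, ρ.apply_symm_apply X⟩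
    · refine Or.inr fun h' => hX ?_
      simp only [μ, if_neg h, h', embed_free]
  have hμu : IsUnifier ts q μ := by
    intro i
    rw [subst_congr fun X hX => hμB X (Or.inr (htse i hX)), hts i]
    simp only [hq, Rule.variantPats, embed_perm_subst]
    refine subst_congr fun X hX => (hμA X (Or.inl (Set.mem_iUnion.2 ⟨i, ?_⟩))).symm
    rwa [FV_embed] at hX
  have hμN : ∀ X ∉ tupleVars (R.variantPats ρ), (μ X).NoBound := by
    intro X hX
    by_cases h : ρ.symm X ∈ A
    · simp only [μ, if_pos h]
      refine hExtra _ fun h' => hX ?_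
      rwa [← mem_variantPats R ρ, ρ.apply_symm_apply] at h'
    · simp only [μ, if_neg h]
      exact ⟨_, rfl⟩
  have hqc : ∀ i, (q i).IsCTerm := fun i =>
    isCTerm_rename.2 ((isCTerm_subst fun X => .free _).2 (R.pats_cterm i))
  -- The arguments unify with c-terms under the c-substitution `μ`.
  have htsc : ∀ i, (ts i).IsCTerm := by
    intro i
    rw [← isCTerm_subst hμc, hμu i, isCTerm_subst hμc]
    exact hqc i
  obtain ⟨δ, hδ, hδu⟩ := exists_isPreMGU_isUnifier htsc hqc hμu
  have hδμ := hδ.general μ hμu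
  -- A pattern variable `Z` in the range of `δ` is fixed by `δ`, so it occurs in an instance `qᵢδ ≡
  -- tᵢδ`, hence in `δ Y` for some `Y` in `tᵢ`. As `μ Y = (δ Y)μ` has no bound variables, neither
  -- has `μ Z`.
  have hδN : ∀ X, ∀ Z ∈ (δ X).FV, (μ Z).NoBound := by
    intro X Z hZ
    by_cases hZp : Z ∈ tupleVars (R.variantPats ρ)
    · have hZδ := (hδ.isCTerm X).eq_free_of_subst_eq (hδ.idem X) hZ
      rw [← hqvars] at hZp
      obtain ⟨i, hi⟩ := Set.mem_iUnion.1 hZp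
      have hZq : Z ∈ ((q i).subst δ).FV := by
        rw [FV_subst]
        exact Set.mem_biUnion hi (by rw [hZδ]; exact rfl)
      rw [← hδu i, FV_subst] at hZq
      simp only [Set.mem_iUnion, exists_prop] at hZq
      obtain ⟨Y, hY, hZY⟩ := hZq
      refine (hδ.isCTerm Y).noBound_of_mem_FV (θ := μ) ?_ hZY
      rw [hδμ]
      exact hμN Y (hPvB Y (Or.inr (htse i hY)))
    · exact hμN Z hZp
  -- By `hδN` the default value is never used on the range of `δ`.
  let θ' : V → LExp S V 0 := fun X => if h : (μ X).NoBound then h.choose else free X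
  have hθ'μ : ∀ X, (μ X).NoBound → (θ' X).embed = μ X := by
    intro X h
    simp only [θ', dif_pos h]
    exact h.choose_spec.symm
  have hθ'δ : ∀ X, (δ X).subst (fun Y => (θ' Y).embed) = μ X := by
    intro X
    rw [subst_congr fun Y hY => hθ'μ Y (hδN X Y hY), hδμ]
  have hθ' : IsCSubst θ' := by
    refine ⟨hμfin.subset fun X hX h => hX ?_, fun X => ?_⟩ <;> by_cases hN : (μ X).NoBound
    · rw [← embed_eq_free (k := k), hθ'μ X hN, h]
    · exact dif_neg hN
    · have := hμc X
      rwa [← hθ'μ X hN, LExp.embed, isCTerm_rename] at this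
    · simp only [θ', dif_neg hN]; exact .free X
  have hδσ : ∀ X, X ∉ tupleVars (R.variantPats ρ) → (δ X).NoBound := fun X hX =>
    (hδ.isCTerm X).noBound_of_subst (by rw [hδμ]; exact hμN X hX)
  let σ : V → LExp S V 0 := fun X =>
    if h : X ∈ tupleVars (R.variantPats ρ) then free X else (hδσ X h).choose
  have hσδ : ∀ X, X ∉ tupleVars (R.variantPats ρ) → δ X = (σ X).embed := by
    intro X h
    simp only [σ, dif_neg h]
    exact (hδσ X h).choose_spec
  have hσB : ∀ X ∈ W ∪ e.FV, (σ X).subst θ' = θ X := by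
    intro X hX
    apply embed_injective (k := k)
    rw [← embed_subst, ← hσδ X (hPvB X hX), hθ'δ, hμB X hX]
  refine ⟨σ, _, θ', .narr C R hR ρ ts ?_ δ hδ.isCSubst hδu (fun _ => hδ.isStandardMGU hδu) σ hσδ
    fun X hX => dif_pos hX, hθ', fun X hX => hσB X (Or.inl hX), ?_⟩
  · refine Set.disjoint_left.2 fun X hX hXe => ?_
    have := hρ (ρ.symm X)
    rw [ρ.apply_symm_apply] at this
    refine this ?_ (Or.inr hXe)
    rw [← ρ.apply_symm_apply X] at hX
    exact hX.imp (mem_variantPats R ρ).1 (mem_variantRhs R ρ).1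
  · rw [Ctx.plug_subst_embed, Ctx.subst_subst, LExp.subst_subst]
    simp only [hθ'δ]
    rw [Rule.variantRhs, embed_perm_subst,
      subst_congr (e := R.rhs.embed) (τ := τ) fun X hX => hμA X (Or.inr (by rwa [FV_embed] at hX))]
    exact C.subst_plug_congr _ _ fun X hX => hσB X (Or.inr hX)

theorem LetRw.lift {e e' : LExp S V 0} {θ : V → LExp S V 0} (hθ : IsCSubst θ)
    (h : LetRw P (e.subst θ) e') {W : Set V} (hW : W.Finite) :
    ∃ σ e₂ θ', LetNarr P True e σ e₂ ∧ IsCSubst θ' ∧ (∀ X ∈ W, (σ X).subst θ' = θ X) ∧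
      e₂.subst θ' = e' := by
  generalize he : e.subst θ = a at h
  cases h with
  | letRule C h =>
    obtain ⟨D, t, rfl, ht, hD⟩ := C.exists_plug_of_subst_eq_plug h.not_isCTerm hθ.2 he
    simp only [rename_eq_embed] at ht
    obtain ⟨t', h', rfl⟩ := LetRule.of_subst hθ.embed.2 (ht ▸ h)
    exact ⟨free, _, θ, .letRule D h', hθ, fun X _ => rfl, by rw [Ctx.plug_subst_embed, hD]⟩
  | fapp C R hR τ hτ hExtra =>
    have hn : ¬ (app (Sum.inr R.f) fun i => (R.pats i).embed.subst τ).IsCTerm := by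
      simp [isCTerm_app_iff]
    obtain ⟨D, t, rfl, ht, hD⟩ := C.exists_plug_of_subst_eq_plug hn hθ.2 he
    simp only [rename_eq_embed] at ht
    rw [← hD]
    cases t with
    | free X => exact (hn (ht ▸ hθ.embed.2 X)).elim
    | bound i => simp at ht
    | letE => simp at ht
    | app g ts =>
      simp only [app_subst, app.injEq] at ht
      obtain ⟨rfl, ht⟩ := ht
      exact LetNarr.lift_fapp D hR hθ hτ hExtra (congrFun (eq_of_heq ht)) hW

/-- A general `W` is needed for the induction: variables introduced by `σ` may no longer occur in
`e'`, yet the remaining derivation must respect `θ'` on them. -/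
theorem LetNarrStar.exists_of_reflTransGen {a e₁ : LExp S V 0}
    (h : Relation.ReflTransGen (LetRw P) a e₁) :
    ∀ (e : LExp S V 0) (θ : V → LExp S V 0) (W : Set V), IsCSubst θ → W.Finite →
      e.subst θ = a → ∃ σ e₂ θ', LetNarrStar P True e σ e₂ ∧ IsCSubst θ' ∧
        (∀ X ∈ W, (σ X).subst θ' = θ X) ∧ e₂.subst θ' = e₁ := by
  induction h using Relation.ReflTransGen.head_induction_on with
  | refl =>
    intro e θ W hθ _ he
    exact ⟨free, e, θ, .refl e, hθ, fun X _ => rfl, he⟩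
  | head h _ ih =>
    rintro e θ W hθ hW rfl
    obtain ⟨σ, e', θ', hn, hθ', hσ, he'⟩ := h.lift hθ hW
    obtain ⟨σ₁, e₂, θ₁, hn₁, hθ₁, hσ₁, he₂⟩ :=
      -- The next set contains all variables of the values of `σ` on `W`.
      ih e' θ' (⋃ X ∈ W, (σ X).FV) hθ' (hW.biUnion fun X _ => finite_FV _) he'
    refine ⟨_, e₂, θ₁, .head hn hn₁, hθ₁, fun X hX => ?_, he₂⟩
    rw [LExp.subst_subst, subst_congr fun Y hY => hσ₁ Y (Set.mem_biUnion hX hY), hσ X hX]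

end Completeness

end LetNarrowing

open LetNarrowing in
theorem mainTheorem7 {S : Signature} {V : Type*} [Countable V] [Infinite V]
    (P : Set (Rule S V)) (e e₁ : LExp S V 0) (θ : V → LExp S V 0) (hθ : IsCSubst θ) :
    (Relation.ReflTransGen (LetRw P) (e.subst θ) e₁ ↔
      ∃ (σ : V → LExp S V 0) (e₂ : LExp S V 0), LetNarrStar P False e σ e₂ ∧
        ∃ θ' : V → LExp S V 0, IsCSubst θ' ∧
          (∀ X ∈ e.FV, (σ X).subst θ' = θ X) ∧ e₂.subst θ' = e₁) ∧
    (Relation.ReflTransGen (LetRw P) (e.subst θ) e₁ →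
      ∃ (σ : V → LExp S V 0) (e₂ : LExp S V 0), LetNarrStar P True e σ e₂ ∧
        ∃ θ' : V → LExp S V 0, IsCSubst θ' ∧
          (∀ X ∈ e.FV, (σ X).subst θ' = θ X) ∧ e₂.subst θ' = e₁) := by
  refine ⟨⟨fun h => ?_, ?_⟩, fun h => ?_⟩
  · obtain ⟨σ, e₂, θ', hn, hθ', hσ, he⟩ :=
      LetNarrStar.exists_of_reflTransGen h e θ e.FV hθ e.finite_FV rfl
    exact ⟨σ, e₂, hn.mono fun _ => trivial, θ', hθ', hσ, he⟩
  · rintro ⟨σ, e₂, hn, θ', hθ', hσ, rfl⟩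
    rw [← LExp.subst_congr hσ, ← LExp.subst_subst]
    exact LetRw.reflTransGen_subst hn.sound.2 hθ'
  · obtain ⟨σ, e₂, θ', hn, hθ', hσ, he⟩ :=
      LetNarrStar.exists_of_reflTransGen h e θ e.FV hθ e.finite_FV rfl
    exact ⟨σ, e₂, hn, θ', hθ', hσ, he⟩
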